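/- Let $d \ge 1$ be an integer and let $\mathcal D_d$ be the set of states on $\mathbb C^d$, i.e. of positive semidefinite complex $d\times d$ matrices $\rho$ with $\operatorname{Tr}\rho = 1$. For $\rho\in\mathcal D_d$ with eigenvalues $\lambda_1,\dots,\lambda_d$ (counted with multiplicity), let $H(\rho) = -\sum_{i=1}^d \lambda_i\log\lambda_i$ be its von Neumann entropy, with the natural logarithm and $0\log 0 = 0$. Let $g:[0,\infty)\to[0,\infty)$, $g(x) = (x+1)\log(x+1) - x\log x$ (a bijection, with $g(0)=0$). For $c\ge 0$ define the entropy power $E_c(\rho) = e^{cH(\rho)}$ and the entropy photon number $N_c(\rho) = g^{-1}(cH(\rho))$. Then: 1. if $0\le c\le 1/(\log d)^2$, the function $E_c$ is concave on $\mathcal D_d$, i.e. $E_c(a\rho+(1-a)\sigma)\ge a\,E_c(\rho)+(1-a)\,E_c(\sigma)$ for all $\rho,\sigma\in\mathcal D_d$ and $a\in[0,1]$; 2. if $0\le c\le 1/(d-1)$, the function $N_c$ is concave on $\mathcal D_d$. For $d=1$ the two upper bounds on $c$ are read as $+\infty$. -/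

import Mathlib

open scoped ComplexOrder

noncomputable section

/-- The states on `ℂ^d`: positive semidefinite `d × d` complex matrices of trace one. -/
def qState (d : ℕ) : Set (Matrix (Fin d) (Fin d) ℂ) :=
  {ρ | ρ.PosSemidef ∧ ρ.trace = 1}

open Classical in
/-- The von Neumann entropy `-∑ i, λ i * log (λ i)`, where the `λ i` are the eigenvalues of the
Hermitian matrix `ρ` with multiplicity (`Real.negMulLog x = -x * log x`, with value `0` at `0`);
the value `0` off the Hermitian matrices is irrelevant, since states are Hermitian. -/
def vonNeumannEntropy {d : ℕ} (ρ : Matrix (Fin d) (Fin d) ℂ) : ℝ :=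
  if h : ρ.IsHermitian then ∑ i, Real.negMulLog (h.eigenvalues i) else 0

/-- The entropy power `e^{c H(ρ)}`. -/
def entropyPower {d : ℕ} (c : ℝ) (ρ : Matrix (Fin d) (Fin d) ℂ) : ℝ :=
  Real.exp (c * vonNeumannEntropy ρ)

/-- `g(x) = (x + 1) log (x + 1) - x log x`, used for `x ≥ 0`; `g(0) = 0` since `0 * log 0 = 0`. -/
def photonG (x : ℝ) : ℝ :=
  (x + 1) * Real.log (x + 1) - x * Real.log x

/-- `g` maps `[0, ∞)` bijectively onto `[0, ∞)`, so that its inverse is defined there. -/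
theorem photonG_bijOn : Set.BijOn photonG (Set.Ici 0) (Set.Ici 0) := by
  have hc : Continuous photonG := by
    unfold photonG
    exact (Real.continuous_mul_log.comp (continuous_add_const 1)).sub Real.continuous_mul_log
  have h0 : photonG 0 = 0 := by simp [photonG]
  have hm : StrictMonoOn photonG (Set.Ici 0) := by
    refine strictMonoOn_of_deriv_pos (convex_Ici 0) hc.continuousOn fun x hx => ?_
    rw [interior_Ici, Set.mem_Ioi] at hx
    have h2 : HasDerivAt (fun z : ℝ => z * Real.log z) (Real.log (x + 1) + 1) (x + 1) :=
      Real.hasDerivAt_mul_log (by positivity)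
    have h1 : HasDerivAt photonG (Real.log (x + 1) + 1 - (Real.log x + 1)) x :=
      (h2.comp_add_const x 1).sub (Real.hasDerivAt_mul_log hx.ne')
    rw [h1.deriv]
    have := Real.log_lt_log hx (lt_add_one x)
    linarith
  have hle : ∀ x, 0 ≤ x → Real.log (x + 1) ≤ photonG x := fun x hx => by
    unfold photonG
    rcases hx.eq_or_lt with rfl | hx
    · simp
    · have := Real.log_lt_log hx (lt_add_one x)
      nlinarith
  refine ⟨fun x hx => ?_, hm.injOn, fun y hy => ?_⟩
  · have := hm.monotoneOn Set.self_mem_Ici hx hx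
    rwa [h0] at this
  · have hx : (0 : ℝ) ≤ Real.exp y - 1 := by
      have := Real.add_one_le_exp y
      have : (0 : ℝ) ≤ y := hy
      linarith
    have h2 := hle _ hx
    rw [sub_add_cancel, Real.log_exp] at h2
    obtain ⟨x, hx', rfl⟩ := intermediate_value_Icc hx hc.continuousOn ⟨h0.trans_le hy, h2⟩
    exact ⟨x, hx'.1, rfl⟩

/-- The inverse of the bijection `g : [0, ∞) → [0, ∞)`: for `y ≥ 0`, the unique `x ≥ 0` with
`g(x) = y`. -/
def photonGInv : ℝ → ℝ :=
  Function.invFunOn photonG (Set.Ici 0)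

/-- The entropy photon number `g⁻¹(c H(ρ))`. -/
def entropyPhotonNumber {d : ℕ} (c : ℝ) (ρ : Matrix (Fin d) (Fin d) ℂ) : ℝ :=
  photonGInv (c * vonNeumannEntropy ρ)

end

/-! The quantum statement reduces to the classical one. In an eigenbasis of the mixture `τ = aρ +
bσ`, dephasing `ρ` and `σ` keeps their mixture equal to the spectrum of `τ` and cannot lower either
entropy, so for monotone `f` it suffices that `f(H(p))` is concave on the simplex. Along a segment
with direction `δ`, `H' = -∑ δ log p` and `H'' = -∑ δ² / p`. Cauchy–Schwarz gives `H'² ≤ -V H''`,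
where `V` is the variance of `log p`. Hence concavity follows from `f' ≥ 0` and `f'' V ≤ f'`
(`concaveOn_shannonEntropy_comp`).

For `f(y) = exp(cy)` the criterion is `cV ≤ 1`, which follows from `V ≤ (log d)²`
(`logVariance_le_log_card_sq`).

For `f(y) = g⁻¹(cy)` it is `cV ≤ v(N)`, where `N = g⁻¹(cH)` and `v(x) = x(x+1)g'(x)²`. As a function
of `g`, `v` is concave, and its tangents have nonnegative slope `B` and intercept `A`. A two-point
distribution `(p, q)` has variance at most `v(pq)` and entropy at least `g(pq)`, so its variance is
at most `A + B` times its entropy. Summing over pairs of weights yields `V ≤ (d-1)A + BH`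
(`logVariance_le_of_pair`). For the tangent at `N`, `c(d-1) ≤ 1` then gives `cV ≤ A + B g(N) =
v(N)`. -/

noncomputable section

/-- The Shannon entropy of a finite family of reals. -/
def shannonEntropy {ι : Type*} [Fintype ι] (p : ι → ℝ) : ℝ :=
  ∑ i, Real.negMulLog (p i)

/-- The variance of `log p` under the weights `p`. -/
def logVariance {ι : Type*} [Fintype ι] (p : ι → ℝ) : ℝ :=
  ∑ i, p i * Real.log (p i) ^ 2 - shannonEntropy p ^ 2

/-- The real diagonal of `ρ` in the orthonormal basis given by the columns of `V`. -/
def diagIn {ι : Type*} [Fintype ι] (V ρ : Matrix ι ι ℂ) (i : ι) : ℝ :=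
  ((star V * ρ * V) i i).re

/-! ### Reduction from states to probability vectors. -/

theorem vonNeumannEntropy_eq {d : ℕ} {ρ : Matrix (Fin d) (Fin d) ℂ} (h : ρ.IsHermitian) :
    vonNeumannEntropy ρ = shannonEntropy h.eigenvalues := by
  simp [vonNeumannEntropy, shannonEntropy, h]

theorem diagIn_convexComb {ι : Type*} [Fintype ι] (V ρ σ : Matrix ι ι ℂ) (a b : ℝ) :
    diagIn V (a • ρ + b • σ) = a • diagIn V ρ + b • diagIn V σ := by
  ext i
  simp [diagIn, mul_add, add_mul]

theorem diagIn_eigenvectorUnitary {ι : Type*} [Fintype ι] [DecidableEq ι] {ρ : Matrix ι ι ℂ}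
    (h : ρ.IsHermitian) : diagIn (h.eigenvectorUnitary : Matrix ι ι ℂ) ρ = h.eigenvalues := by
  ext i
  have := h.conjStarAlgAut_star_eigenvectorUnitary
  rw [Unitary.conjStarAlgAut_star_apply] at this
  simp [diagIn, this]

theorem sum_normSq_row {ι : Type*} [Fintype ι] [DecidableEq ι] {W : Matrix ι ι ℂ}
    (hW : W * star W = 1) (i : ι) : ∑ k, Complex.normSq (W i k) = 1 := by
  have h := congrFun (congrFun hW i) i
  rw [Matrix.mul_apply] at h
  simp only [Matrix.star_apply, Matrix.one_apply_eq, ← starRingEnd_apply, Complex.mul_conj] at h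
  exact_mod_cast h

theorem sum_normSq_col {ι : Type*} [Fintype ι] [DecidableEq ι] {W : Matrix ι ι ℂ}
    (hW : star W * W = 1) (k : ι) : ∑ i, Complex.normSq (W i k) = 1 := by
  have h := congrFun (congrFun hW k) k
  rw [Matrix.mul_apply] at h
  simp only [Matrix.star_apply, Matrix.one_apply_eq, ← starRingEnd_apply, mul_comm,
    Complex.mul_conj] at h
  exact_mod_cast h

/-- The diagonal of a Hermitian matrix in any orthonormal basis is the image of its spectrum under
a doubly stochastic matrix. -/
theorem exists_diagIn_eq_sum {ι : Type*} [Fintype ι] [DecidableEq ι] {ρ : Matrix ι ι ℂ}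
    (h : ρ.IsHermitian) (V : Matrix.unitaryGroup ι ℂ) :
    ∃ D : ι → ι → ℝ, (∀ i k, 0 ≤ D i k) ∧ (∀ i, ∑ k, D i k = 1) ∧ (∀ k, ∑ i, D i k = 1) ∧
      ∀ i, diagIn (V : Matrix ι ι ℂ) ρ i = ∑ k, D i k * h.eigenvalues k := by
  set U := h.eigenvectorUnitary with hU
  have h1 : (star V * U : Matrix.unitaryGroup ι ℂ).1 * star (star V * U).1 = 1 :=
    Unitary.coe_mul_star_self _
  have h2 : star (star V * U : Matrix.unitaryGroup ι ℂ).1 * (star V * U).1 = 1 :=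
    Unitary.coe_star_mul_self _
  refine ⟨fun i k => Complex.normSq ((star V * U : Matrix.unitaryGroup ι ℂ).1 i k),
    fun _ _ => Complex.normSq_nonneg _, sum_normSq_row h1, sum_normSq_col h2, fun i => ?_⟩
  have h3 : star (V : Matrix ι ι ℂ) * ρ * (V : Matrix ι ι ℂ) = (star V * U : Matrix.unitaryGroup ι ℂ).1 *
      Matrix.diagonal (RCLike.ofReal ∘ h.eigenvalues) * star (star V * U).1 := by
    conv_lhs => rw [h.spectral_theorem, Unitary.conjStarAlgAut_apply]
    simp [mul_assoc, hU]
  rw [diagIn, h3, Matrix.mul_apply, Complex.re_sum]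
  refine Finset.sum_congr rfl fun k _ => ?_
  rw [Matrix.mul_diagonal, Matrix.star_apply, ← starRingEnd_apply, mul_right_comm,
    Complex.mul_conj]
  simp

theorem eigenvalues_mem_stdSimplex {d : ℕ} {ρ : Matrix (Fin d) (Fin d) ℂ} (hρ : ρ ∈ qState d) :
    hρ.1.1.eigenvalues ∈ stdSimplex ℝ (Fin d) := by
  refine ⟨hρ.1.eigenvalues_nonneg, ?_⟩
  have h := hρ.1.1.trace_eq_sum_eigenvalues.symm.trans hρ.2
  simpa using congrArg Complex.re h

theorem diagIn_mem_stdSimplex {d : ℕ} {ρ : Matrix (Fin d) (Fin d) ℂ} (hρ : ρ ∈ qState d)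
    (V : Matrix.unitaryGroup (Fin d) ℂ) :
    diagIn (V : Matrix (Fin d) (Fin d) ℂ) ρ ∈ stdSimplex ℝ (Fin d) := by
  obtain ⟨D, h0, -, hcol, hD⟩ := exists_diagIn_eq_sum hρ.1.1 V
  obtain ⟨hl, hs⟩ := eigenvalues_mem_stdSimplex hρ
  refine ⟨fun i => ?_, ?_⟩
  · rw [hD]
    exact Finset.sum_nonneg fun k _ => mul_nonneg (h0 i k) (hl k)
  · simp_rw [hD]
    rw [Finset.sum_comm]
    simp_rw [← Finset.sum_mul, hcol, one_mul, hs]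

/-- Dephasing in an orthonormal basis does not decrease the entropy. -/
theorem vonNeumannEntropy_le_shannonEntropy_diagIn {d : ℕ} {ρ : Matrix (Fin d) (Fin d) ℂ}
    (hρ : ρ ∈ qState d) (V : Matrix.unitaryGroup (Fin d) ℂ) :
    vonNeumannEntropy ρ ≤ shannonEntropy (diagIn (V : Matrix (Fin d) (Fin d) ℂ) ρ) := by
  obtain ⟨D, h0, hrow, hcol, hD⟩ := exists_diagIn_eq_sum hρ.1.1 V
  obtain ⟨hl, -⟩ := eigenvalues_mem_stdSimplex hρ
  rw [vonNeumannEntropy_eq hρ.1.1]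
  calc shannonEntropy hρ.1.1.eigenvalues
      = ∑ i, ∑ k, D i k * Real.negMulLog (hρ.1.1.eigenvalues k) := by
        rw [Finset.sum_comm]
        simp_rw [← Finset.sum_mul, hcol, one_mul, shannonEntropy]
    _ ≤ _ := Finset.sum_le_sum fun i _ => by
        rw [hD]
        simpa using Real.concaveOn_negMulLog.le_map_sum (t := Finset.univ) (w := D i)
          (p := hρ.1.1.eigenvalues) (fun k _ => h0 i k) (hrow i) (fun k _ => hl k)

theorem le_one_of_mem_stdSimplex {ι : Type*} [Fintype ι] {p : ι → ℝ} (hp : p ∈ stdSimplex ℝ ι)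
    (i : ι) : p i ≤ 1 :=
  hp.2 ▸ Finset.single_le_sum (fun j _ => hp.1 j) (Finset.mem_univ i)

theorem shannonEntropy_nonneg {ι : Type*} [Fintype ι] {p : ι → ℝ} (hp : p ∈ stdSimplex ℝ ι) :
    0 ≤ shannonEntropy p :=
  Finset.sum_nonneg fun i _ => Real.negMulLog_nonneg (hp.1 i)
    (le_one_of_mem_stdSimplex hp i)

theorem convex_qState (d : ℕ) : Convex ℝ (qState d) := by
  rintro ρ ⟨hρ, hρt⟩ σ ⟨hσ, hσt⟩ a b ha hb hab
  refine ⟨(hρ.smul ha).add (hσ.smul hb), ?_⟩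
  rw [Matrix.trace_add, Matrix.trace_smul, Matrix.trace_smul, hρt, hσt]
  rw [← add_smul, hab, one_smul]

/-- A monotone function of the von Neumann entropy is concave as soon as the corresponding function
of the Shannon entropy is. -/
theorem concaveOn_vonNeumannEntropy_comp {d : ℕ} {f : ℝ → ℝ} (hf : MonotoneOn f (Set.Ici 0))
    (hc : ConcaveOn ℝ (stdSimplex ℝ (Fin d)) fun p => f (shannonEntropy p)) :
    ConcaveOn ℝ (qState d) fun ρ => f (vonNeumannEntropy ρ) := by
  refine ⟨convex_qState d, fun ρ hρ σ hσ a b ha hb hab => ?_⟩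
  have hτ := convex_qState d hρ hσ ha hb hab
  -- Both states are dephased in the eigenbasis of the mixture, where the mixture is already
  -- diagonal.
  have key : ∀ ⦃μ⦄, μ ∈ qState d → f (vonNeumannEntropy μ) ≤
      f (shannonEntropy (diagIn (hτ.1.1.eigenvectorUnitary : Matrix (Fin d) (Fin d) ℂ) μ)) :=
    fun μ hμ => by
      have h1 := vonNeumannEntropy_le_shannonEntropy_diagIn hμ hτ.1.1.eigenvectorUnitary
      have h0 : 0 ≤ vonNeumannEntropy μ := by
        rw [vonNeumannEntropy_eq hμ.1.1]
        exact shannonEntropy_nonneg (eigenvalues_mem_stdSimplex hμ)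
      exact hf h0 (h0.trans h1) h1
  have h2 := hc.2 (diagIn_mem_stdSimplex hρ hτ.1.1.eigenvectorUnitary)
    (diagIn_mem_stdSimplex hσ hτ.1.1.eigenvectorUnitary) ha hb hab
  rw [← diagIn_convexComb, diagIn_eigenvectorUnitary] at h2
  simp only [← vonNeumannEntropy_eq] at h2
  refine le_trans ?_ h2
  exact add_le_add (smul_le_smul_of_nonneg_left (key hρ) ha)
    (smul_le_smul_of_nonneg_left (key hσ) hb)

/-! ### Second order criterion on the simplex. -/

theorem shannonEntropy_eq {ι : Type*} [Fintype ι] (p : ι → ℝ) :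
    shannonEntropy p = -∑ i, p i * Real.log (p i) := by
  simp [shannonEntropy, Real.negMulLog]

theorem logVariance_eq_sum_sq {ι : Type*} [Fintype ι] {p : ι → ℝ} (hp : ∑ i, p i = 1) :
    logVariance p = ∑ i, p i * (Real.log (p i) + shannonEntropy p) ^ 2 := by
  have h : ∀ i, p i * (Real.log (p i) + shannonEntropy p) ^ 2 = p i * Real.log (p i) ^ 2 +
      2 * shannonEntropy p * (p i * Real.log (p i)) + p i * shannonEntropy p ^ 2 :=
    fun i => by ring
  have h2 : ∑ i, p i * Real.log (p i) = -shannonEntropy p := by rw [shannonEntropy_eq, neg_neg]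
  simp_rw [h, Finset.sum_add_distrib, ← Finset.mul_sum, ← Finset.sum_mul, hp, h2, logVariance]
  ring

/-- Cauchy–Schwarz for the derivative of the entropy in the direction `δ`. -/
theorem sq_sum_mul_log_le {ι : Type*} [Fintype ι] {x δ : ι → ℝ} (hx : x ∈ stdSimplex ℝ ι)
    (hδ : ∑ i, δ i = 0) (h0 : ∀ i, x i = 0 → δ i = 0) :
    (∑ i, δ i * Real.log (x i)) ^ 2 ≤ (∑ i, δ i ^ 2 / x i) * logVariance x := by
  -- As `δ` sums to zero, `log x` may be centred at its mean `-H` for free.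
  have h : ∑ i, δ i * Real.log (x i) = ∑ i, δ i * (Real.log (x i) + shannonEntropy x) := by
    simp_rw [mul_add, Finset.sum_add_distrib, ← Finset.sum_mul, hδ]
    simp
  rw [h, logVariance_eq_sum_sq hx.2]
  refine Finset.sum_sq_le_sum_mul_sum_of_sq_le_mul _ (fun i _ => div_nonneg (sq_nonneg _) (hx.1 i))
    (fun i _ => mul_nonneg (hx.1 i) (sq_nonneg _)) fun i _ => le_of_eq ?_
  rcases eq_or_ne (x i) 0 with hi | hi
  · simp [h0 i hi]
  · field_simp

/-- Second order criterion for the concavity of a function of the Shannon entropy. -/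
theorem concaveOn_shannonEntropy_comp {ι : Type*} [Fintype ι] {f f' f'' : ℝ → ℝ}
    (hf : ContinuousOn f (Set.Ici 0)) (hf' : ∀ y, 0 < y → HasDerivAt f (f' y) y)
    (hf'' : ∀ y, 0 < y → HasDerivAt f' (f'' y) y) (hpos : ∀ y, 0 < y → 0 ≤ f' y)
    (hvar : ∀ p ∈ stdSimplex ℝ ι, 0 < shannonEntropy p →
      f'' (shannonEntropy p) * logVariance p ≤ f' (shannonEntropy p)) :
    ConcaveOn ℝ (stdSimplex ℝ ι) fun p => f (shannonEntropy p) := by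
  refine ⟨convex_stdSimplex ℝ ι, fun p hp q hq a b ha hb hab => ?_⟩
  rcases eq_or_ne p q with rfl | hne
  · rw [← add_smul, ← add_smul, hab, one_smul, one_smul]
  set δ : ι → ℝ := fun i => q i - p i with hδdef
  have hδ : ∑ i, δ i = 0 := by simp [hδdef, hp.2, hq.2]
  set x : ℝ → ι → ℝ := fun t i => p i + t * δ i with hxdef
  have hxeq : ∀ t i, x t i = (1 - t) * p i + t * q i := fun t i => by
    simp only [hxdef, hδdef]; ring
  have hxmem : ∀ t ∈ Set.Icc (0 : ℝ) 1, x t ∈ stdSimplex ℝ ι := fun t ht => by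
    have := convex_stdSimplex ℝ ι hp hq (sub_nonneg.2 ht.2) ht.1 (sub_add_cancel 1 t)
    convert this using 1
    ext i
    simp [hxeq]
  -- A coordinate vanishing at an interior point vanishes on the whole segment, so the singularity
  -- of `log` at `0` never matters.
  have hx0 : ∀ t ∈ Set.Ioo (0 : ℝ) 1, ∀ i, x t i = 0 → δ i = 0 := fun t ht i hi => by
    rw [hxeq] at hi
    have h1 := mul_nonneg (sub_nonneg.2 ht.2.le) (hp.1 i)
    have h2 := mul_nonneg ht.1.le (hq.1 i)
    have h3 : (1 - t) * p i = 0 := by linarith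
    have h4 : t * q i = 0 := by linarith
    have h5 : p i = 0 := (mul_eq_zero.1 h3).resolve_left (sub_pos.2 ht.2).ne'
    have h6 : q i = 0 := (mul_eq_zero.1 h4).resolve_left ht.1.ne'
    simp [hδdef, h5, h6]
  -- An interior point of a nondegenerate segment is not a vertex of the simplex; this is why
  -- derivatives of `f` are needed only on `y > 0`.
  have hHpos : ∀ t ∈ Set.Ioo (0 : ℝ) 1, 0 < shannonEntropy (x t) := fun t ht => by
    have hm := hxmem t ⟨ht.1.le, ht.2.le⟩
    obtain ⟨i, hi⟩ := Function.ne_iff.1 hne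
    have hi0 : δ i ≠ 0 := fun h => hi (by simp only [hδdef] at h; linarith)
    have hxi : x t i ≠ 0 := fun h => hi0 (hx0 t ht i h)
    have hxi1 : x t i ≠ 1 := fun h => by
      rw [hxeq] at h
      have h1 := mul_le_of_le_one_right (sub_nonneg.2 ht.2.le) (le_one_of_mem_stdSimplex hp i)
      have h2 := mul_le_of_le_one_right ht.1.le (le_one_of_mem_stdSimplex hq i)
      have h3 : (1 - t) * (p i - 1) = 0 := by linarith
      have h4 : t * (q i - 1) = 0 := by linarith
      have h5 := (mul_eq_zero.1 h3).resolve_left (sub_pos.2 ht.2).ne'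
      have h6 := (mul_eq_zero.1 h4).resolve_left ht.1.ne'
      exact hi (by linarith)
    refine Finset.sum_pos' (fun j _ => Real.negMulLog_nonneg (hm.1 j)
      (le_one_of_mem_stdSimplex hm j)) ⟨i, Finset.mem_univ i, ?_⟩
    have h1 : 0 < x t i := lt_of_le_of_ne (hm.1 i) hxi.symm
    have h2 := Real.log_neg h1 (lt_of_le_of_ne (le_one_of_mem_stdSimplex hm i) hxi1)
    rw [Real.negMulLog]
    nlinarith
  have hxd : ∀ t i, HasDerivAt (fun s => x s i) (δ i) t := fun t i => by
    have h := ((hasDerivAt_id t).mul_const (δ i)).const_add (p i)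
    rw [one_mul] at h
    exact h
  have hH' : ∀ t ∈ Set.Ioo (0 : ℝ) 1, HasDerivAt (fun s => shannonEntropy (x s))
      (-∑ i, δ i * Real.log (x t i)) t := fun t ht => by
    have h : HasDerivAt (fun s => shannonEntropy (x s))
        (∑ i, -(δ i * Real.log (x t i) + δ i)) t := by
      refine HasDerivAt.fun_sum fun i _ => ?_
      rcases eq_or_ne (x t i) 0 with hi | hi
      · have h0 := hx0 t ht i hi
        simp only [hxdef, h0]
        simpa using hasDerivAt_const t (Real.negMulLog (p i))
      · have := (Real.hasDerivAt_negMulLog hi).comp t (hxd t i)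
        exact this.congr_deriv (by ring)
    convert h using 1
    simp [Finset.sum_add_distrib, hδ]
  have hH'' : ∀ t ∈ Set.Ioo (0 : ℝ) 1, HasDerivAt (fun s => -∑ i, δ i * Real.log (x s i))
      (-∑ i, δ i ^ 2 / x t i) t := fun t ht => by
    refine HasDerivAt.neg (HasDerivAt.fun_sum fun i _ => ?_)
    rcases eq_or_ne (x t i) 0 with hi | hi
    · have h0 := hx0 t ht i hi
      simpa [h0] using hasDerivAt_const t (0 : ℝ)
    · exact (((hxd t i).log hi).const_mul (δ i)).congr_deriv (by ring)
  have hcont : ContinuousOn (fun s => f (shannonEntropy (x s))) (Set.Icc 0 1) := by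
    refine hf.comp (Continuous.continuousOn ?_) fun s hs => shannonEntropy_nonneg (hxmem s hs)
    refine continuous_finsetSum _ fun i _ => Real.continuous_negMulLog.comp ?_
    simp only [hxdef]
    fun_prop
  have hconc : ConcaveOn ℝ (Set.Icc (0 : ℝ) 1) fun s => f (shannonEntropy (x s)) := by
    refine concaveOn_of_hasDerivWithinAt2_nonpos (convex_Icc 0 1) hcont
      (f' := fun t => f' (shannonEntropy (x t)) * -∑ i, δ i * Real.log (x t i))
      (f'' := fun t => f'' (shannonEntropy (x t)) * (-∑ i, δ i * Real.log (x t i)) *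
        (-∑ i, δ i * Real.log (x t i)) + f' (shannonEntropy (x t)) * (-∑ i, δ i ^ 2 / x t i))
      ?_ ?_ ?_
    all_goals rw [interior_Icc]
    · exact fun t ht => ((hf' _ (hHpos t ht)).comp t (hH' t ht)).hasDerivWithinAt
    · exact fun t ht =>
        (((hf'' _ (hHpos t ht)).comp t (hH' t ht)).mul (hH'' t ht)).hasDerivWithinAt
    · intro t ht
      have hm := hxmem t ⟨ht.1.le, ht.2.le⟩
      have hcs := sq_sum_mul_log_le hm hδ (hx0 t ht)
      have hv := hvar _ hm (hHpos t ht)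
      have hp' := hpos _ (hHpos t ht)
      have hS : 0 ≤ ∑ i, δ i ^ 2 / x t i :=
        Finset.sum_nonneg fun i _ => div_nonneg (sq_nonneg _) (hm.1 i)
      generalize f'' (shannonEntropy (x t)) = F2 at *
      generalize f' (shannonEntropy (x t)) = F1 at *
      generalize ∑ i, δ i ^ 2 / x t i = S at *
      generalize ∑ i, δ i * Real.log (x t i) = T at *
      rcases le_total F2 0 with h | h
      · nlinarith [mul_nonneg hp' hS, mul_nonneg (neg_nonneg.2 h) (sq_nonneg T)]
      · nlinarith [mul_le_mul_of_nonneg_left hcs h, mul_le_mul_of_nonneg_right hv hS]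
  have h := hconc.2 (Set.left_mem_Icc.2 zero_le_one) (Set.right_mem_Icc.2 zero_le_one) ha hb hab
  have e0 : x 0 = p := by ext i; simp [hxdef]
  have e1 : x 1 = q := by ext i; simp [hxdef, hδdef]
  have e2 : x (a • 0 + b • 1) = a • p + b • q := by
    ext i
    rw [hxeq, ← hab]
    simp only [smul_eq_mul, Pi.add_apply, Pi.smul_apply]
    ring_nf
    rw [show a = 1 - b by linarith]
    ring
  simpa only [e0, e1, e2] using h

/-! ### Variance of `log p` from pairs of weights. -/

/-- Convexity of `y ↦ y log y` between `x` and `1`. -/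
theorem add_mul_log_sub_log_le {x y : ℝ} (hx : 0 < x) (hy : 0 ≤ y) (hxy : x + y ≤ 1) :
    (x + y) * (Real.log (x + y) - Real.log x) ≤ y / (1 - x) * -Real.log x := by
  rcases hy.eq_or_lt with rfl | hy
  · simp
  have h1 : 0 < 1 - x := by linarith
  set θ := y / (1 - x) with hθ
  have hθy : θ * (1 - x) = y := div_mul_cancel₀ _ h1.ne'
  have hθ0 : 0 ≤ θ := by positivity
  have hθ1 : θ ≤ 1 := by rw [hθ, div_le_one h1]; linarith
  have h := Real.convexOn_mul_log.2 (x := x) hx.le (y := 1) (zero_le_one' ℝ) (sub_nonneg.2 hθ1) hθ0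
    (sub_add_cancel 1 θ)
  simp only [smul_eq_mul, Real.log_one, mul_zero, add_zero, mul_one] at h
  rw [show (1 - θ) * x + θ = x + y by rw [← hθy]; ring] at h
  have h2 : (x + y) * Real.log x = ((1 - θ) * x + θ) * Real.log x := by rw [← hθy]; ring
  linarith

/-- A bound on pairs of weights gives a bound on the variance of `log p`. -/
theorem logVariance_le_of_pair {ι : Type*} [Fintype ι] {A B : ℝ} (hA : 0 ≤ A) (hB : 0 ≤ B)
    (hpair : ∀ x y, 0 < x → 0 < y → x * y * (Real.log x - Real.log y) ^ 2 ≤ A * (x + y) ^ 2 +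
      B * ((x + y) * (x * (Real.log (x + y) - Real.log x) + y * (Real.log (x + y) - Real.log y))))
    {p : ι → ℝ} (hp : p ∈ stdSimplex ℝ ι) :
    logVariance p ≤ A * (Fintype.card ι - 1) + B * shannonEntropy p := by
  classical
  have hadd : ∀ i j, i ≠ j → p i + p j ≤ 1 := fun i j hij => by
    rw [← hp.2, ← Finset.sum_pair hij]
    exact Finset.sum_le_sum_of_subset_of_nonneg (Finset.subset_univ _) fun k _ _ => hp.1 k
  set a : ι → ι → ℝ := fun i j =>
    if i = j then 0 else p i * ((p i + p j) * (Real.log (p i + p j) - Real.log (p i))) with ha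
  set s : ι → ι → ℝ := fun i j => if i = j then 0 else p i with hs
  have ha0 : ∀ i j, 0 ≤ a i j := fun i j => by
    simp only [ha]
    split_ifs
    · rfl
    · rcases (hp.1 i).eq_or_lt with h | h
      · simp [← h]
      · have := Real.log_le_log h (le_add_of_nonneg_right (hp.1 j))
        have h' := hp.1 j
        exact mul_nonneg h.le (mul_nonneg (by linarith) (by linarith))
  have hs0 : ∀ i j, 0 ≤ s i j := fun i j => by
    simp only [hs]
    split_ifs
    · rfl
    · exact hp.1 i
  have hterm : ∀ i j, p i * p j * (Real.log (p i) - Real.log (p j)) ^ 2 ≤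
      A * (s i j + s j i) + B * (a i j + a j i) := fun i j => by
    have hR : 0 ≤ A * (s i j + s j i) + B * (a i j + a j i) :=
      add_nonneg (mul_nonneg hA (add_nonneg (hs0 i j) (hs0 j i)))
        (mul_nonneg hB (add_nonneg (ha0 i j) (ha0 j i)))
    rcases eq_or_ne i j with rfl | hij
    · simpa using hR
    rcases (hp.1 i).eq_or_lt with hi | hi
    · simpa [← hi] using hR
    rcases (hp.1 j).eq_or_lt with hj | hj
    · simpa [← hj] using hR
    refine (hpair _ _ hi hj).trans ?_
    simp only [ha, hs, hij, hij.symm, if_false]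
    -- Replacing the square by `p i + p j` makes the `A`-terms sum to a multiple of `card ι - 1`.
    have h1 : (p i + p j) ^ 2 ≤ p i + p j := by nlinarith [hadd i j hij]
    rw [add_comm (p j) (p i)]
    have h2 := mul_le_mul_of_nonneg_left h1 hA
    linarith
  have hrow_s : ∀ i, ∑ j, s i j = p i * (Fintype.card ι - 1) := fun i => by
    have : ∀ j, s i j = p i - if i = j then p i else 0 := fun j => by
      simp only [hs]; split_ifs <;> simp
    simp_rw [this, Finset.sum_sub_distrib]
    simp
    ring
  have hrow_a : ∀ i, ∑ j, a i j ≤ Real.negMulLog (p i) := fun i => by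
    rcases (hp.1 i).eq_or_lt with hi | hi
    · simp [ha, ← hi]
    have hl : 0 ≤ -Real.log (p i) := neg_nonneg.2 (Real.log_nonpos hi.le
      (le_one_of_mem_stdSimplex hp i))
    have h1 : ∀ j, a i j ≤ p i * ((p j - if i = j then p i else 0) / (1 - p i) *
        -Real.log (p i)) := fun j => by
      rcases eq_or_ne i j with rfl | hij
      · simp [ha]
      · simp only [ha, hij, if_false, sub_zero]
        exact mul_le_mul_of_nonneg_left (add_mul_log_sub_log_le hi (hp.1 j) (hadd i j hij)) hi.le
    refine (Finset.sum_le_sum fun j _ => h1 j).trans ?_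
    rw [← Finset.mul_sum, ← Finset.sum_mul, ← Finset.sum_div, Finset.sum_sub_distrib, hp.2]
    simp only [Finset.sum_ite_eq, Finset.mem_univ, if_true]
    rw [Real.negMulLog, neg_mul, ← mul_neg]
    refine mul_le_mul_of_nonneg_left ?_ hi.le
    -- The quotient is `0 / 0 = 0` when `p i = 1`, hence `≤ 1` rather than `= 1`.
    exact mul_le_of_le_one_left hl (div_self_le_one _)
  have hvar : 2 * logVariance p = ∑ i, ∑ j, p i * p j * (Real.log (p i) - Real.log (p j)) ^ 2 := by
    have h : ∀ i j, p i * p j * (Real.log (p i) - Real.log (p j)) ^ 2 =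
        p i * Real.log (p i) ^ 2 * p j + p i * (p j * Real.log (p j) ^ 2) -
          2 * (p i * Real.log (p i)) * (p j * Real.log (p j)) := fun i j => by ring
    simp_rw [h, Finset.sum_sub_distrib, Finset.sum_add_distrib, ← Finset.mul_sum,
      ← Finset.sum_mul, ← Finset.mul_sum, hp.2, logVariance, shannonEntropy_eq]
    ring
  have hS : ∑ i, ∑ j, (A * (s i j + s j i) + B * (a i j + a j i)) =
      2 * (A * ∑ i, ∑ j, s i j + B * ∑ i, ∑ j, a i j) := by
    simp_rw [Finset.sum_add_distrib, ← Finset.mul_sum, Finset.sum_add_distrib]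
    rw [Finset.sum_comm (f := fun i j => s j i), Finset.sum_comm (f := fun i j => a j i)]
    ring
  have h1 := Finset.sum_le_sum fun i (_ : i ∈ Finset.univ) =>
    Finset.sum_le_sum fun j (_ : j ∈ Finset.univ) => hterm i j
  have h2 : ∑ i, ∑ j, a i j ≤ shannonEntropy p := Finset.sum_le_sum fun i _ => hrow_a i
  rw [← hvar, hS] at h1
  simp_rw [hrow_s, ← Finset.sum_mul, hp.2, one_mul] at h1
  have h3 := mul_le_mul_of_nonneg_left h2 hB
  linarith

/-! ### The bound `V ≤ (log d)²` and the entropy power. -/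

theorem one_add_sq_div_two_le_cosh {w : ℝ} (hw : 0 ≤ w) : 1 + w ^ 2 / 2 ≤ Real.cosh w := by
  have h1 : w / 2 ≤ Real.sinh (w / 2) := Real.self_le_sinh_iff.2 (by linarith)
  have h2 : Real.cosh w = 1 + 2 * Real.sinh (w / 2) ^ 2 := by
    conv_lhs => rw [show w = 2 * (w / 2) by ring]
    rw [Real.cosh_two_mul, Real.cosh_sq]
    ring
  nlinarith

/-- Doubling the angle in the quadratic bound for `cosh (u / 2)` gives a quartic lower bound for
`cosh u`, sharp enough even with `0.69` in place of `log 2`. -/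
theorem self_le_log_two_mul_cosh {u : ℝ} (hu : 0 ≤ u) : u ≤ Real.log 2 * Real.cosh u := by
  have h1 := one_add_sq_div_two_le_cosh (w := u / 2) (by linarith)
  have h2 : Real.cosh u = 2 * Real.cosh (u / 2) ^ 2 - 1 := by
    conv_lhs => rw [show u = 2 * (u / 2) by ring]
    rw [Real.cosh_two_mul, Real.sinh_sq]
    ring
  have h3 : 1 + u ^ 2 / 2 + u ^ 4 / 32 ≤ Real.cosh u := by
    rw [h2]
    nlinarith [sq_nonneg u]
  have h4 := Real.log_two_gt_d9
  have h5 : u ≤ 0.69 * (1 + u ^ 2 / 2 + u ^ 4 / 32) := by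
    nlinarith [sq_nonneg (u ^ 2 - 1.5), sq_nonneg (u - 1.25)]
  have h6 : 0 ≤ Real.cosh u := (Real.cosh_pos u).le
  nlinarith

/-- With `u` half the difference of the logarithms, `(x + y)² = 4xy cosh² u`, so this is `|u| ≤ log
2 * cosh u`. -/
theorem mul_mul_log_sub_log_sq_le {x y : ℝ} (hx : 0 < x) (hy : 0 < y) :
    x * y * (Real.log x - Real.log y) ^ 2 ≤ Real.log 2 ^ 2 * (x + y) ^ 2 := by
  set u := (Real.log x - Real.log y) / 2 with hu
  have h1 : u ^ 2 ≤ (Real.log 2 * Real.cosh u) ^ 2 := by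
    rw [← sq_abs, ← Real.cosh_abs]
    exact pow_le_pow_left₀ (abs_nonneg u) (self_le_log_two_mul_cosh (abs_nonneg u)) 2
  have h2 : 4 * (x * y) * Real.cosh u ^ 2 = (x + y) ^ 2 := by
    have h := Real.cosh_two_mul u
    rw [Real.sinh_sq, show 2 * u = Real.log (x / y) by rw [Real.log_div hx.ne' hy.ne', hu]; ring,
      Real.cosh_log (div_pos hx hy)] at h
    have h' : Real.cosh u ^ 2 = ((x / y + (x / y)⁻¹) / 2 + 1) / 2 := by linarith
    rw [h']
    field_simp
    ring
  have h3 : x * y * (Real.log x - Real.log y) ^ 2 = 4 * (x * y) * u ^ 2 := by rw [hu]; ring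
  rw [h3, ← h2]
  calc 4 * (x * y) * u ^ 2 ≤ 4 * (x * y) * (Real.log 2 * Real.cosh u) ^ 2 := by gcongr
    _ = _ := by ring

theorem logVariance_le_log_two_sq_mul {ι : Type*} [Fintype ι] {p : ι → ℝ}
    (hp : p ∈ stdSimplex ℝ ι) : logVariance p ≤ Real.log 2 ^ 2 * (Fintype.card ι - 1) := by
  have h := logVariance_le_of_pair (A := Real.log 2 ^ 2) (B := 0) (sq_nonneg _) le_rfl
    (fun x y hx hy => by simpa using mul_mul_log_sub_log_sq_le hx hy) hp
  simpa using h

/-- For `l ≤ 2`, squaring `exp (-l / 2) ≥ 1 - l / 2 ≥ 0` suffices; for `l ≥ 2`, dropping the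
exponential leaves `l² ≤ 2l(l - 1) ≤ 2L(l - 1)`. -/
theorem sq_div_le_exp_neg_sub {l L : ℝ} (hL : 2 ≤ L) (hl : l ≤ L) :
    l ^ 2 ≤ 2 * L * (Real.exp (-l) - 1 + l) := by
  rcases le_total l 2 with h | h
  · have h1 : -(l / 2) + 1 ≤ Real.exp (-(l / 2)) := Real.add_one_le_exp _
    have h2 : Real.exp (-l) = Real.exp (-(l / 2)) ^ 2 := by
      rw [← Real.exp_nat_mul]
      congr 1
      push_cast
      ring
    have h3 : l ^ 2 / 4 ≤ Real.exp (-l) - 1 + l := by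
      rw [h2]
      nlinarith
    nlinarith [sq_nonneg l]
  · have := Real.exp_pos (-l)
    nlinarith

/-- The tangent at `1 / d` of the function `x log² x`. -/
theorem mul_log_sq_le_tangent {x d : ℝ} (hx : 0 ≤ x) (hx1 : x ≤ 1) (hd : 0 < d)
    (hL : 2 ≤ Real.log d) :
    x * Real.log x ^ 2 ≤ (Real.log d ^ 2 - 2 * Real.log d) * x + 2 * Real.log d / d := by
  rcases hx.eq_or_lt with rfl | hx
  · simp only [zero_mul, mul_zero, zero_add]
    positivity
  -- `l = log (d x)` measures the distance from the point of tangency.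
  have h := sq_div_le_exp_neg_sub (l := Real.log x + Real.log d) hL
    (by linarith [Real.log_nonpos hx.le hx1])
  have he : x * Real.exp (-(Real.log x + Real.log d)) = 1 / d := by
    rw [← Real.log_mul hx.ne' hd.ne', ← Real.log_inv, Real.exp_log (by positivity)]
    field_simp
  have h2 := mul_le_mul_of_nonneg_left h hx.le
  have h3 : x * (2 * Real.log d * (Real.exp (-(Real.log x + Real.log d)) - 1 +
      (Real.log x + Real.log d))) = 2 * Real.log d / d +
      x * (2 * Real.log d * (-1 + (Real.log x + Real.log d))) := by
    linear_combination (2 * Real.log d) * he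
  rw [h3] at h2
  linarith

/-- Summing the tangent bound at `1 / d` over the `d` weights cancels the terms `2 log d`; the `-H²`
in the variance is discarded. -/
theorem logVariance_le_log_card_sq_of_two_le {ι : Type*} [Fintype ι] {p : ι → ℝ}
    (hp : p ∈ stdSimplex ℝ ι) (hι : 2 ≤ Real.log (Fintype.card ι)) :
    logVariance p ≤ Real.log (Fintype.card ι) ^ 2 := by
  have hd : (0 : ℝ) < Fintype.card ι := by
    rcases (Nat.cast_nonneg (α := ℝ) (Fintype.card ι)).eq_or_lt with h | h
    · rw [← h, Real.log_zero] at hι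
      norm_num at hι
    · exact h
  have h := Finset.sum_le_sum fun i (_ : i ∈ Finset.univ) =>
    mul_log_sq_le_tangent (hp.1 i) (le_one_of_mem_stdSimplex hp i) hd hι
  rw [Finset.sum_add_distrib, ← Finset.mul_sum, hp.2] at h
  simp only [Finset.sum_const, Finset.card_univ, nsmul_eq_mul, mul_one] at h
  rw [mul_div_cancel₀ _ hd.ne'] at h
  have := sq_nonneg (shannonEntropy p)
  rw [logVariance]
  linarith

theorem mul_log_le_mul_log_of_pow_le {a b m n : ℕ} (ha : 0 < a) (h : a ^ m ≤ b ^ n) :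
    m * Real.log a ≤ n * Real.log b := by
  rw [← Real.log_pow, ← Real.log_pow]
  exact Real.log_le_log (by positivity) (by exact_mod_cast h)

theorem log_two_sq_mul_le_log_sq {d : ℕ} (h1 : 1 ≤ d) (h7 : d ≤ 7) :
    Real.log 2 ^ 2 * (d - 1) ≤ Real.log d ^ 2 := by
  -- A rational lower bound `m / n` for `log d / log 2` with `d - 1 ≤ (m / n)²` suffices.
  have key : ∀ m n : ℕ, 2 ^ m ≤ d ^ n → (d - 1) * (n : ℝ) ^ 2 ≤ (m : ℝ) ^ 2 → 0 < n →
      Real.log 2 ^ 2 * (d - 1) ≤ Real.log d ^ 2 := fun m n h hmn hn => by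
    have h2 := mul_log_le_mul_log_of_pow_le two_pos h
    push_cast at h2
    have h3 := pow_le_pow_left₀ (by positivity) h2 2
    have hn' : (0 : ℝ) < (n : ℝ) ^ 2 := by positivity
    refine le_of_mul_le_mul_left ?_ hn'
    nlinarith [mul_le_mul_of_nonneg_left hmn (sq_nonneg (Real.log 2))]
  interval_cases d
  · exact key 0 1 (by norm_num) (by norm_num) one_pos
  · exact key 1 1 (by norm_num) (by norm_num) one_pos
  · exact key 3 2 (by norm_num) (by norm_num) two_pos
  · exact key 2 1 (by norm_num) (by norm_num) one_pos
  · exact key 2 1 (by norm_num) (by norm_num) one_pos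
  · exact key 5 2 (by norm_num) (by norm_num) two_pos
  · exact key 5 2 (by norm_num) (by norm_num) two_pos

theorem logVariance_le_log_card_sq {ι : Type*} [Fintype ι] {p : ι → ℝ}
    (hp : p ∈ stdSimplex ℝ ι) : logVariance p ≤ Real.log (Fintype.card ι) ^ 2 := by
  -- From `d = 8` on, `log d ≥ 3 log 2 > 2`, so the tangent argument applies.
  rcases le_or_gt (Fintype.card ι) 7 with h | h
  · refine (logVariance_le_log_two_sq_mul hp).trans (log_two_sq_mul_le_log_sq ?_ h)
    rw [Nat.one_le_iff_ne_zero]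
    intro h0
    have := Fintype.card_eq_zero_iff.1 h0
    simpa using hp.2
  · refine logVariance_le_log_card_sq_of_two_le hp ?_
    have h1 := mul_log_le_mul_log_of_pow_le (a := 2) (b := Fintype.card ι) (m := 3) (n := 1)
      two_pos (by rw [pow_one]; omega)
    have := Real.log_two_gt_d9
    push_cast at h1
    linarith

theorem concaveOn_exp_shannonEntropy {ι : Type*} [Fintype ι] {c : ℝ} (hc : 0 ≤ c)
    (h : c * Real.log (Fintype.card ι) ^ 2 ≤ 1) :
    ConcaveOn ℝ (stdSimplex ℝ ι) fun p => Real.exp (c * shannonEntropy p) := by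
  have hd : ∀ y, HasDerivAt (fun y => Real.exp (c * y)) (c * Real.exp (c * y)) y := fun y => by
    simpa [mul_comm] using ((hasDerivAt_id y).const_mul c).exp
  refine concaveOn_shannonEntropy_comp (f := fun y => Real.exp (c * y))
    (f' := fun y => c * Real.exp (c * y)) (f'' := fun y => c * (c * Real.exp (c * y)))
    (by fun_prop) (fun y _ => hd y) (fun y _ => (hd y).const_mul c) (fun y _ => by positivity)
    fun p hp _ => ?_
  have h1 : c * logVariance p ≤ 1 :=
    (mul_le_mul_of_nonneg_left (logVariance_le_log_card_sq hp) hc).trans h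
  have h2 : 0 ≤ c * Real.exp (c * shannonEntropy p) := by positivity
  nlinarith

/-! ### Calculus of `g` and of the geometric variance. -/

/-- The derivative of `photonG`. -/
def photonGDeriv (x : ℝ) : ℝ := Real.log (x + 1) - Real.log x

/-- The variance of the logarithm of a geometric distribution of mean `x`. -/
def photonVariance (x : ℝ) : ℝ := x * (x + 1) * photonGDeriv x ^ 2

/-- The derivative of `photonVariance` with respect to `photonG`. -/
def photonSlope (x : ℝ) : ℝ := (2 * x + 1) * photonGDeriv x - 2

theorem continuous_photonG : Continuous photonG :=
  (Real.continuous_mul_log.comp (continuous_add_const 1)).sub Real.continuous_mul_log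

theorem hasDerivAt_photonG {x : ℝ} (hx : 0 < x) : HasDerivAt photonG (photonGDeriv x) x := by
  have h2 : HasDerivAt (fun z : ℝ => z * Real.log z) (Real.log (x + 1) + 1) (x + 1) :=
    Real.hasDerivAt_mul_log (by positivity)
  exact ((h2.comp_add_const x 1).sub (Real.hasDerivAt_mul_log hx.ne')).congr_deriv
    (by rw [photonGDeriv]; ring)

theorem photonGDeriv_pos {x : ℝ} (hx : 0 < x) : 0 < photonGDeriv x :=
  sub_pos.2 (Real.log_lt_log hx (lt_add_one x))

theorem hasDerivAt_photonGDeriv {x : ℝ} (hx : 0 < x) :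
    HasDerivAt photonGDeriv (-(x * (x + 1))⁻¹) x := by
  have h1 : HasDerivAt (fun z : ℝ => Real.log (z + 1)) (x + 1)⁻¹ x :=
    (Real.hasDerivAt_log (by positivity)).comp_add_const x 1
  refine (h1.sub (Real.hasDerivAt_log hx.ne')).congr_deriv ?_
  field_simp
  ring

theorem log_le_sub_inv_div_two {y : ℝ} (hy : 1 ≤ y) : Real.log y ≤ (y - y⁻¹) / 2 := by
  rw [← Real.sinh_log (by linarith)]
  exact Real.self_le_sinh_iff.2 (Real.log_nonneg hy)

theorem two_mul_div_le_neg_log {x : ℝ} (hx : 0 < x) (hx1 : x ≤ 1) :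
    2 * (1 - x) / (1 + x) ≤ -Real.log x := by
  have h := Real.le_log_one_add_of_nonneg (x := x⁻¹ - 1) (sub_nonneg.2 ((one_le_inv₀ hx).2 hx1))
  rw [add_sub_cancel, Real.log_inv] at h
  rw [show x⁻¹ - 1 + 2 = (1 + x) / x by field_simp; ring] at h
  refine le_of_eq_of_le ?_ h
  field_simp

theorem photonGDeriv_eq_log_div {x : ℝ} (hx : 0 < x) :
    photonGDeriv x = Real.log ((x + 1) / x) :=
  (Real.log_div (by positivity) hx.ne').symm

theorem photonGDeriv_le {x : ℝ} (hx : 0 < x) :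
    photonGDeriv x ≤ (2 * x + 1) / (2 * (x * (x + 1))) := by
  rw [photonGDeriv_eq_log_div hx]
  refine (log_le_sub_inv_div_two ((one_le_div hx).2 (by linarith))).trans_eq ?_
  field_simp
  ring

theorem photonSlope_nonneg {x : ℝ} (hx : 0 < x) : 0 ≤ photonSlope x := by
  have h := two_mul_div_le_neg_log (x := x / (x + 1)) (by positivity)
    ((div_le_one (by positivity)).2 (by linarith))
  rw [← Real.log_inv, inv_div, ← photonGDeriv_eq_log_div hx] at h
  have h2 : 2 * (1 - x / (x + 1)) / (1 + x / (x + 1)) = 2 / (2 * x + 1) := by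
    field_simp
    ring
  rw [h2, div_le_iff₀ (by positivity)] at h
  rw [photonSlope]
  linarith

theorem hasDerivAt_photonSlope {x : ℝ} (hx : 0 < x) :
    HasDerivAt photonSlope (2 * photonGDeriv x - (2 * x + 1) / (x * (x + 1))) x := by
  have h1 : HasDerivAt (fun z : ℝ => 2 * z + 1) 2 x := by
    simpa using ((hasDerivAt_id x).const_mul 2).add_const 1
  refine ((h1.mul (hasDerivAt_photonGDeriv hx)).sub_const 2).congr_deriv ?_
  ring

theorem antitoneOn_photonSlope : AntitoneOn photonSlope (Set.Ioi 0) := by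
  refine antitoneOn_of_deriv_nonpos (convex_Ioi 0)
    (fun x hx => (hasDerivAt_photonSlope hx).continuousAt.continuousWithinAt) ?_ ?_
  all_goals rw [interior_Ioi]
  · exact fun x hx => (hasDerivAt_photonSlope hx).differentiableAt.differentiableWithinAt
  · intro x hx
    have hx : 0 < x := hx
    rw [(hasDerivAt_photonSlope hx).deriv]
    have h := photonGDeriv_le hx
    have h2 : (2 * x + 1) / (x * (x + 1)) = 2 * ((2 * x + 1) / (2 * (x * (x + 1)))) := by
      field_simp
    linarith

theorem hasDerivAt_photonVariance {x : ℝ} (hx : 0 < x) :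
    HasDerivAt photonVariance (photonGDeriv x * photonSlope x) x := by
  have h1 : HasDerivAt (fun z : ℝ => z * (z + 1)) (2 * x + 1) x :=
    ((hasDerivAt_id x).mul ((hasDerivAt_id x).add_const 1)).congr_deriv (by simp; ring)
  refine (h1.mul ((hasDerivAt_photonGDeriv hx).pow 2)).congr_deriv ?_
  rw [photonSlope]
  field_simp
  simp
  ring

/-- `photonVariance` lies below its tangents as a function of `photonG`. -/
theorem photonVariance_le_tangent {x y : ℝ} (hx : 0 < x) (hy : 0 < y) :
    photonVariance x ≤ photonVariance y + photonSlope y * (photonG x - photonG y) := by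
  -- The derivative changes sign from nonnegative to nonpositive at `y`, because the slope is
  -- antitone; so the difference is maximal there.
  have hd : ∀ z, 0 < z → HasDerivAt (fun z => photonVariance z - photonSlope y * photonG z)
      (photonGDeriv z * (photonSlope z - photonSlope y)) z := fun z hz =>
    ((hasDerivAt_photonVariance hz).sub ((hasDerivAt_photonG hz).const_mul _)).congr_deriv
      (by ring)
  suffices h : photonVariance x - photonSlope y * photonG x ≤
      photonVariance y - photonSlope y * photonG y by linarith
  rcases le_total x y with hxy | hxy
  · have hm : MonotoneOn (fun z => photonVariance z - photonSlope y * photonG z)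
        (Set.Icc x y) := by
      refine monotoneOn_of_deriv_nonneg (convex_Icc x y) (fun z hz =>
        (hd z (hx.trans_le hz.1)).continuousAt.continuousWithinAt) ?_ ?_
      all_goals rw [interior_Icc]
      · exact fun z hz => (hd z (hx.trans hz.1)).differentiableAt.differentiableWithinAt
      · intro z hz
        have hz0 := hx.trans hz.1
        rw [(hd z hz0).deriv]
        exact mul_nonneg (photonGDeriv_pos hz0).le
          (sub_nonneg.2 (antitoneOn_photonSlope hz0 hy hz.2.le))
    exact hm (Set.left_mem_Icc.2 hxy) (Set.right_mem_Icc.2 hxy) hxy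
  · have hm : AntitoneOn (fun z => photonVariance z - photonSlope y * photonG z)
        (Set.Icc y x) := by
      refine antitoneOn_of_deriv_nonpos (convex_Icc y x) (fun z hz =>
        (hd z (hy.trans_le hz.1)).continuousAt.continuousWithinAt) ?_ ?_
      all_goals rw [interior_Icc]
      · exact fun z hz => (hd z (hy.trans hz.1)).differentiableAt.differentiableWithinAt
      · intro z hz
        have hz0 := hy.trans hz.1
        rw [(hd z hz0).deriv]
        exact mul_nonpos_of_nonneg_of_nonpos (photonGDeriv_pos hz0).le
          (sub_nonpos.2 (antitoneOn_photonSlope hy hz0 hz.1.le))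
    exact hm (Set.left_mem_Icc.2 hxy) (Set.right_mem_Icc.2 hxy) hxy

theorem photonG_zero : photonG 0 = 0 := by simp [photonG]

theorem photonVariance_nonneg {x : ℝ} (hx : 0 ≤ x) : 0 ≤ photonVariance x := by
  rw [photonVariance]
  positivity

/-- The tangents of `photonVariance` as a function of `photonG` have nonnegative intercepts. -/
theorem photonSlope_mul_photonG_le {y : ℝ} (hy : 0 < y) :
    photonSlope y * photonG y ≤ photonVariance y := by
  -- The tangent bound is taken to the limit `x → 0+`, where `photonG` vanishes.
  have h : Filter.Tendsto (fun x => photonVariance y + photonSlope y * (photonG x - photonG y))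
      (nhdsWithin 0 (Set.Ioi 0))
      (nhds (photonVariance y + photonSlope y * (photonG 0 - photonG y))) :=
    (Continuous.tendsto (by have := continuous_photonG; fun_prop) 0).mono_left nhdsWithin_le_nhds
  have h2 := ge_of_tendsto h (b := 0) (by
    filter_upwards [self_mem_nhdsWithin] with x hx
    exact (photonVariance_nonneg (le_of_lt hx)).trans (photonVariance_le_tangent hx hy))
  rw [photonG_zero] at h2
  linarith

/-! ### Two-point distributions against the geometric variance. -/

/-- The entropy of a pair `(p, q)` dominates `photonG (p * q)`. -/
theorem photonG_mul_le {p q : ℝ} (hp : 0 < p) (hq : 0 < q) (hpq : p + q = 1) :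
    photonG (p * q) ≤ p * -Real.log p + q * -Real.log q := by
  have hw : 0 < p * q := mul_pos hp hq
  -- Since `pq = p - p² = q - q²`, the claim amounts to `(pq+1) log (pq+1) ≤ -p² log p - q² log q`
  -- (see `h8`); rational bounds on the logarithms turn it into a polynomial inequality in `pq`.
  have h1 : (p * q + 1) * Real.log (p * q + 1) ≤ p * q + (p * q) ^ 2 / 2 := by
    have h := mul_le_mul_of_nonneg_left (log_le_sub_inv_div_two (y := p * q + 1) (by linarith))
      (by positivity : 0 ≤ p * q + 1)
    refine h.trans_eq ?_
    field_simp
    ring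
  have h2 := mul_le_mul_of_nonneg_left (two_mul_div_le_neg_log hp (by linarith)) (sq_nonneg p)
  have h3 := mul_le_mul_of_nonneg_left (two_mul_div_le_neg_log hq (by linarith)) (sq_nonneg q)
  have h4 : p * q + (p * q) ^ 2 / 2 ≤
      p ^ 2 * (2 * (1 - p) / (1 + p)) + q ^ 2 * (2 * (1 - q) / (1 + q)) := by
    have e : p ^ 2 * (2 * (1 - p) / (1 + p)) + q ^ 2 * (2 * (1 - q) / (1 + q)) =
        2 * (p * q) * (1 + 2 * (p * q)) / (2 + p * q) := by
      obtain rfl : q = 1 - p := by linarith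
      have h5 : 1 + (1 - p) ≠ 0 := by linarith
      have h6 : 2 + p * (1 - p) ≠ 0 := by positivity
      field_simp
      ring
    rw [e, le_div_iff₀ (by positivity)]
    have h7 : p * q ≤ 1 := by nlinarith
    nlinarith [mul_pos hw hw, mul_pos hw (mul_pos hw hw)]
  have h8 : photonG (p * q) = (p * q + 1) * Real.log (p * q + 1) + p * -Real.log p +
      q * -Real.log q - p ^ 2 * -Real.log p - q ^ 2 * -Real.log q := by
    rw [photonG, Real.log_mul hp.ne' hq.ne']
    obtain rfl : q = 1 - p := by linarith
    ring
  linarith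

/-- Both `-log p` and `-log q` are nonnegative, so `|log p - log q| ≤ log (pq+1) - log p - log q`,
which is `photonGDeriv (pq)`. -/
theorem mul_log_sub_log_sq_le_photonVariance {p q : ℝ} (hp : 0 < p) (hq : 0 < q)
    (hpq : p + q = 1) : p * q * (Real.log p - Real.log q) ^ 2 ≤ photonVariance (p * q) := by
  have hw : 0 < p * q := mul_pos hp hq
  have h1 := Real.log_nonneg (by linarith : 1 ≤ p * q + 1)
  have h2 := Real.log_nonpos hp.le (by linarith)
  have h3 := Real.log_nonpos hq.le (by linarith)
  have h4 : (Real.log p - Real.log q) ^ 2 ≤ photonGDeriv (p * q) ^ 2 := by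
    rw [photonGDeriv, Real.log_mul hp.ne' hq.ne']
    exact sq_le_sq' (by linarith) (by linarith)
  rw [photonVariance]
  have h5 := sq_nonneg (photonGDeriv (p * q))
  nlinarith [mul_le_mul_of_nonneg_left h4 hw.le, mul_nonneg (sq_nonneg (p * q)) h5]

/-- Both sides are homogeneous of degree two, so `x + y = 1` may be assumed; there the tangent at
`z` links the variance and entropy bounds for a pair. -/
theorem mul_mul_log_sub_log_sq_le_of_photon {x y z : ℝ} (hx : 0 < x) (hy : 0 < y) (hz : 0 < z) :
    x * y * (Real.log x - Real.log y) ^ 2 ≤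
      (photonVariance z - photonSlope z * photonG z) * (x + y) ^ 2 + photonSlope z *
        ((x + y) * (x * (Real.log (x + y) - Real.log x) +
          y * (Real.log (x + y) - Real.log y))) := by
  have hs : 0 < x + y := add_pos hx hy
  have hp : 0 < x / (x + y) := div_pos hx hs
  have hq : 0 < y / (x + y) := div_pos hy hs
  have hpq : x / (x + y) + y / (x + y) = 1 := by rw [← add_div, div_self hs.ne']
  have h1 := mul_log_sub_log_sq_le_photonVariance hp hq hpq
  have h2 := photonVariance_le_tangent (mul_pos hp hq) hz
  have h3 := mul_le_mul_of_nonneg_left (photonG_mul_le hp hq hpq) (photonSlope_nonneg hz)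
  have h4 : x / (x + y) * (y / (x + y)) *
      (Real.log (x / (x + y)) - Real.log (y / (x + y))) ^ 2 ≤
      photonVariance z - photonSlope z * photonG z + photonSlope z *
        (x / (x + y) * -Real.log (x / (x + y)) + y / (x + y) * -Real.log (y / (x + y))) := by
    linarith
  rw [Real.log_div hx.ne' hs.ne', Real.log_div hy.ne' hs.ne'] at h4
  have h5 := mul_le_mul_of_nonneg_left h4 (sq_nonneg (x + y))
  have e1 : (x + y) * (x / (x + y)) = x := mul_div_cancel₀ x hs.ne'
  have e2 : (x + y) * (y / (x + y)) = y := mul_div_cancel₀ y hs.ne'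
  generalize x / (x + y) = a at *
  generalize y / (x + y) = b at *
  linear_combination h5 + (photonSlope z * (x + y) * (Real.log (x + y) - Real.log x) -
    (Real.log x - Real.log y) ^ 2 * (x + y) * b) * e1 +
    (photonSlope z * (x + y) * (Real.log (x + y) - Real.log y) -
      (Real.log x - Real.log y) ^ 2 * x) * e2

/-! ### The inverse of `g` and the entropy photon number. -/

theorem strictMonoOn_photonG : StrictMonoOn photonG (Set.Ici 0) := by
  refine strictMonoOn_of_deriv_pos (convex_Ici 0) continuous_photonG.continuousOn fun x hx => ?_
  rw [interior_Ici] at hx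
  rw [(hasDerivAt_photonG hx).deriv]
  exact photonGDeriv_pos hx

theorem photonG_photonGInv {y : ℝ} (hy : 0 ≤ y) : photonG (photonGInv y) = y :=
  photonG_bijOn.surjOn.rightInvOn_invFunOn hy

theorem photonGInv_nonneg {y : ℝ} (hy : 0 ≤ y) : 0 ≤ photonGInv y :=
  photonG_bijOn.surjOn.mapsTo_invFunOn hy

theorem photonGInv_photonG {x : ℝ} (hx : 0 ≤ x) : photonGInv (photonG x) = x :=
  photonG_bijOn.injOn.leftInvOn_invFunOn hx

theorem photonGInv_pos {y : ℝ} (hy : 0 < y) : 0 < photonGInv y := by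
  refine lt_of_le_of_ne (photonGInv_nonneg hy.le) fun h => hy.ne ?_
  rw [← photonG_photonGInv hy.le, ← h, photonG_zero]

theorem strictMonoOn_photonGInv : StrictMonoOn photonGInv (Set.Ici 0) := fun a ha b hb hab => by
  rw [← strictMonoOn_photonG.lt_iff_lt (photonGInv_nonneg ha) (photonGInv_nonneg hb),
    photonG_photonGInv ha, photonG_photonGInv hb]
  exact hab

theorem surjOn_photonGInv : Set.SurjOn photonGInv (Set.Ici 0) (Set.Ici 0) := fun x hx =>
  ⟨photonG x, photonG_bijOn.mapsTo hx, photonGInv_photonG hx⟩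

theorem continuousAt_photonGInv {y : ℝ} (hy : 0 < y) : ContinuousAt photonGInv y :=
  strictMonoOn_photonGInv.continuousAt_of_image_mem_nhds (Ici_mem_nhds hy)
    (Filter.mem_of_superset (Ici_mem_nhds (photonGInv_pos hy)) surjOn_photonGInv)

theorem continuousOn_photonGInv : ContinuousOn photonGInv (Set.Ici 0) := fun y hy => by
  rcases eq_or_lt_of_le (Set.mem_Ici.1 hy) with rfl | hy
  · exact strictMonoOn_photonGInv.continuousWithinAt_right_of_surjOn self_mem_nhdsWithin
      (surjOn_photonGInv.mono subset_rfl fun x hx => (photonGInv_nonneg le_rfl).trans (le_of_lt hx))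
  · exact (continuousAt_photonGInv hy).continuousWithinAt

theorem hasDerivAt_photonGInv {y : ℝ} (hy : 0 < y) :
    HasDerivAt photonGInv (photonGDeriv (photonGInv y))⁻¹ y := by
  have hN := photonGInv_pos hy
  refine HasDerivAt.of_local_left_inverse (continuousAt_photonGInv hy) (hasDerivAt_photonG hN)
    (photonGDeriv_pos hN).ne' ?_
  filter_upwards [Ici_mem_nhds hy] with z hz using photonG_photonGInv hz

/-- The pair bound is used with the tangent at `N` itself, where the tangent value is exactly
`photonVariance N`; `c (d - 1) ≤ 1` absorbs the intercept. -/
theorem logVariance_mul_le_photonVariance {ι : Type*} [Fintype ι] {c : ℝ} (hc : 0 < c)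
    (h : c * ((Fintype.card ι : ℝ) - 1) ≤ 1) {p : ι → ℝ} (hp : p ∈ stdSimplex ℝ ι)
    (hH : 0 < shannonEntropy p) :
    c * logVariance p ≤ photonVariance (photonGInv (c * shannonEntropy p)) := by
  have hy : 0 < c * shannonEntropy p := mul_pos hc hH
  have hN := photonGInv_pos hy
  set N := photonGInv (c * shannonEntropy p) with hNdef
  have hg : photonG N = c * shannonEntropy p := photonG_photonGInv hy.le
  have hA : 0 ≤ photonVariance N - photonSlope N * photonG N :=
    sub_nonneg.2 (photonSlope_mul_photonG_le hN)
  have h1 := logVariance_le_of_pair hA (photonSlope_nonneg hN)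
    (fun x y hx hy => mul_mul_log_sub_log_sq_le_of_photon hx hy hN) hp
  have h2 := mul_le_mul_of_nonneg_left h1 hc.le
  have h3 := mul_le_mul_of_nonneg_left h hA
  have h4 : photonSlope N * photonG N = photonSlope N * (c * shannonEntropy p) := by rw [hg]
  linarith

theorem concaveOn_photonGInv_shannonEntropy {ι : Type*} [Fintype ι] {c : ℝ} (hc : 0 ≤ c)
    (h : c * ((Fintype.card ι : ℝ) - 1) ≤ 1) :
    ConcaveOn ℝ (stdSimplex ℝ ι) fun p => photonGInv (c * shannonEntropy p) := by
  rcases hc.eq_or_lt with rfl | hc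
  · simpa using concaveOn_const (photonGInv 0) (convex_stdSimplex ℝ ι)
  have hd : ∀ y, 0 < y → HasDerivAt (fun y => photonGInv (c * y))
      (c * (photonGDeriv (photonGInv (c * y)))⁻¹) y := fun y hy => by
    refine ((hasDerivAt_photonGInv (mul_pos hc hy)).comp y
      ((hasDerivAt_id y).const_mul c)).congr_deriv ?_
    ring
  have hd2 : ∀ y, 0 < y → HasDerivAt (fun y => c * (photonGDeriv (photonGInv (c * y)))⁻¹)
      (c ^ 2 / (photonVariance (photonGInv (c * y)) * photonGDeriv (photonGInv (c * y)))) y :=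
    fun y hy => by
      have hN := photonGInv_pos (mul_pos hc hy)
      have ht := photonGDeriv_pos hN
      have h1 : HasDerivAt (fun y => photonGDeriv (photonGInv (c * y))) _ y :=
        HasDerivAt.comp (h₂ := photonGDeriv) y (hasDerivAt_photonGDeriv hN) (hd y hy)
      refine ((h1.inv ht.ne').const_mul c).congr_deriv ?_
      simp only [photonVariance]
      field_simp
  refine concaveOn_shannonEntropy_comp (f := fun y => photonGInv (c * y))
    (continuousOn_photonGInv.comp (by fun_prop) fun y hy => mul_nonneg hc.le hy) hd hd2
    -- With these derivatives, `f'' V ≤ f'` becomes `c V ≤ photonVariance N` after clearing positive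
    -- factors.
    (fun y hy => mul_nonneg hc.le
      (inv_nonneg.2 (photonGDeriv_pos (photonGInv_pos (mul_pos hc hy))).le)) fun p hp hH => ?_
  have hN := photonGInv_pos (mul_pos hc hH)
  have ht := photonGDeriv_pos hN
  have hv : 0 < photonVariance (photonGInv (c * shannonEntropy p)) := by
    rw [photonVariance]
    positivity
  have h1 := logVariance_mul_le_photonVariance hc h hp hH
  rw [← div_eq_mul_inv, div_mul_eq_mul_div, div_le_div_iff₀ (mul_pos hv ht) ht]
  nlinarith [mul_le_mul_of_nonneg_left h1 (mul_pos hc ht).le]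

/-- The bounds `c ≤ 1 / (log d)²` and `c ≤ 1 / (d - 1)` are written without division, so that they
read `c < ∞` when `d = 1`. -/
theorem theorem2 (d : ℕ) (c : ℝ) (hc : 0 ≤ c) :
    (c * Real.log d ^ 2 ≤ 1 → ConcaveOn ℝ (qState d) (entropyPower c)) ∧
    (c * ((d : ℝ) - 1) ≤ 1 → ConcaveOn ℝ (qState d) (entropyPhotonNumber c)) := by
  refine ⟨fun h => ?_, fun h => ?_⟩
  · refine concaveOn_vonNeumannEntropy_comp (f := fun y => Real.exp (c * y))
      (fun a _ b _ hab => Real.exp_le_exp.2 (mul_le_mul_of_nonneg_left hab hc))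
      (concaveOn_exp_shannonEntropy hc ?_)
    rwa [Fintype.card_fin]
  · refine concaveOn_vonNeumannEntropy_comp (f := fun y => photonGInv (c * y))
      (fun a ha b hb hab => strictMonoOn_photonGInv.monotoneOn (mul_nonneg hc ha)
        (mul_nonneg hc hb) (mul_le_mul_of_nonneg_left hab hc))
      (concaveOn_photonGInv_shannonEntropy hc ?_)
    rwa [Fintype.card_fin]

end
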